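/- Let $U\subseteq\mathbb{R}$ be open and let $\alpha\in\mathbb{R}$. Write $\mathcal{D}(U)$ for the complex-valued smooth functions with compact support in $U$, and $\mathcal{D}'(U)$ for the space of distributions on $U$. A tempered distribution $f\in\mathcal{S}'(\mathbb{R})$ is called a pseudomeasure if its Fourier transform $\hat f$ belongs to $L^\infty(\mathbb{R})$, and a pseudofunction if, in addition, $\hat f(x)\to0$ as $|x|\to\infty$ (off a null set); these notions do not depend on the normalization of the Fourier transform. A distribution $g\in\mathcal{D}'(U)$ is called a local pseudofunction (local pseudomeasure) on $U$ if every $t_0\in U$ has an open neighborhood $V\subseteq U$ on which $g$ coincides with a pseudofunction (pseudomeasure). Let $G$ be analytic on the half-plane $\operatorname{Re}s>\alpha$, and suppose that $g\in\mathcal{D}'(U)$ is the boundary distribution of $G$ on $\alpha+iU$, that is, $$\lim_{\sigma\to\alpha^+}\int_{-\infty}^{\infty}G(\sigma+it)\varphi(t)\,dt=\langle g(t),\varphi(t)\rangle\qquad\text{for every }\varphi\in\mathcal{D}(U).$$ Then, for every $\varphi\in\mathcal{D}(U)$ and every $n\in\mathbb{N}$, $$\langle g(t),e^{iht}\varphi(t)\rangle=O\!\left(\frac1{|h|^n}\right)\qquad\text{as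 }h\to-\infty .$$ Moreover: 1. $g$ is a local pseudofunction on $U$ if and only if, for every $\varphi\in\mathcal{D}(U)$, $\langle g(t),e^{iht}\varphi(t)\rangle=o(1)$ as $h\to+\infty$. 2. $g$ is a local pseudomeasure on $U$ if and only if, for every $\varphi\in\mathcal{D}(U)$, $\langle g(t),e^{iht}\varphi(t)\rangle=O(1)$ as $h\to+\infty$. -/

import Mathlib

open Set Filter Topology MeasureTheory TopologicalSpace
open scoped Distributions SchwartzMap FourierTransform ContDiff

noncomputable section

namespace PseudoDist

/-- A global pseudomeasure: a tempered distribution on `ℝ` whose Fourier transform is (the tempered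
distribution given by) a function in `L^∞`. This does not depend on the normalization of the Fourier
transform, since other normalizations only rescale the transform. -/
def IsPseudomeasure (f : 𝓢'(ℝ, ℂ)) : Prop :=
  ∃ u : Lp ℂ ⊤ (volume : Measure ℝ), 𝓕 f = (u : 𝓢'(ℝ, ℂ))

/-- A global pseudofunction: a pseudomeasure whose Fourier transform `u ∈ L^∞` tends to `0` as
`|x| → ∞`. As `u` is a class of functions modulo equality almost everywhere, the limit is taken off
a null set; equivalently, some representative of `u` tends to `0`. -/
def IsPseudofunction (f : 𝓢'(ℝ, ℂ)) : Prop :=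
  ∃ u : Lp ℂ ⊤ (volume : Measure ℝ), 𝓕 f = (u : 𝓢'(ℝ, ℂ)) ∧
    Tendsto (fun x : ℝ => u x) (cocompact ℝ ⊓ ae volume) (𝓝 0)

variable {U : Opens ℝ}

/-- A test function on `U`, regarded as a Schwartz function on `ℝ`. -/
def toSchwartz (φ : 𝓓(U, ℂ)) : 𝓢(ℝ, ℂ) :=
  φ.hasCompactSupport.toSchwartzMap φ.contDiff

theorem toSchwartz_apply (φ : 𝓓(U, ℂ)) (t : ℝ) : toSchwartz φ t = φ t := rfl

/-- The distribution `g ∈ 𝓓'(U)` coincides with the tempered distribution `f` on `U ∩ V`. -/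
def CoincidesOn (g : 𝓓(U, ℂ) →L[ℂ] ℂ) (f : 𝓢'(ℝ, ℂ)) (V : Set ℝ) : Prop :=
  ∀ φ : 𝓓(U, ℂ), tsupport φ ⊆ V → g φ = f (toSchwartz φ)

/-- `g` is a pseudofunction at every point of `U`: each point has an open neighborhood on which `g`
coincides with a global pseudofunction. -/
def IsLocalPseudofunction (g : 𝓓(U, ℂ) →L[ℂ] ℂ) : Prop :=
  ∀ t₀ ∈ U, ∃ V : Opens ℝ, t₀ ∈ V ∧ V ≤ U ∧
    ∃ f : 𝓢'(ℝ, ℂ), IsPseudofunction f ∧ CoincidesOn g f V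

/-- `g` is a pseudomeasure at every point of `U`: each point has an open neighborhood on which `g`
coincides with a global pseudomeasure. -/
def IsLocalPseudomeasure (g : 𝓓(U, ℂ) →L[ℂ] ℂ) : Prop :=
  ∀ t₀ ∈ U, ∃ V : Opens ℝ, t₀ ∈ V ∧ V ≤ U ∧
    ∃ f : 𝓢'(ℝ, ℂ), IsPseudomeasure f ∧ CoincidesOn g f V

/-- The test function `t ↦ e^{iht} φ(t)`. -/
def modulate (h : ℝ) (φ : 𝓓(U, ℂ)) : 𝓓(U, ℂ) where
  toFun t := Complex.exp (Complex.I * h * t) * φ t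
  contDiff' := by
    have h1 : ContDiff ℝ ((⊤ : ℕ∞) : WithTop ℕ∞)
        (fun t : ℝ => Complex.exp (Complex.I * h * t)) :=
      (contDiff_const.mul Complex.ofRealCLM.contDiff).cexp
    exact h1.mul φ.contDiff
  hasCompactSupport' := φ.hasCompactSupport.mul_left
  tsupport_subset' := (tsupport_mul_subset_right).trans φ.tsupport_subset

theorem modulate_apply (h : ℝ) (φ : 𝓓(U, ℂ)) (t : ℝ) :
    modulate h φ t = Complex.exp (Complex.I * h * t) * φ t := rfl

/-- `g` is the distributional boundary value of `G` on `α + iU`, approached from `Re s > α`: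
`∫ G(σ + it) φ(t) dt → ⟨g, φ⟩` as `σ → α⁺`, for every test function `φ` on `U`. -/
def IsBoundaryValue (G : ℂ → ℂ) (α : ℝ) (g : 𝓓(U, ℂ) →L[ℂ] ℂ) : Prop :=
  ∀ φ : 𝓓(U, ℂ),
    Tendsto (fun σ : ℝ => ∫ t : ℝ, G (σ + t * Complex.I) * φ t) (𝓝[>] α) (𝓝 (g φ))

end PseudoDist

end

/-! Write `P σ φ` for `∫ G(σ+it) φ(t) dt`. The Cauchy–Riemann equation and integration by parts give
`∂_σ P σ φ = i P σ φ'`. Applied to `e^{iht}φ`, this is the linear equation `f' = -h f + i P σ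
(e^{iht}φ')`. For `h < 0` it is integrated backwards from `σ = α + 1`, where `f` decays rapidly in
`h` because `G` is smooth there; the forcing term loses a factor `1/|h|`. Each pass thus trades one
derivative of `φ` for one power of `|h|`, uniformly as `σ → α⁺` (`norm_le_of_hasDerivAt_neg_mul`,
`IsBoundaryValue.exists_uniform_decay`).

The iteration needs an initial polynomial bound in `h`, uniform in `σ`. It comes from
Banach–Steinhaus on a space of coefficient sequences of exponential series
(`exists_polynomial_bound_of_series`). A Fourier expansion then makes the order of growth common to
`φ`, `φ'`, `φ''`, … (`IsBoundaryValue.exists_uniform_order`).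

For the equivalences, let `χ = 1` near a point. There `g` has the Fourier side `ξ ↦ ⟨g,
e^{-2πiξt}χ⟩` (`IsBoundaryValue.apply_eq_integral`). The half-line `h → -∞` is controlled
automatically, so a condition at `+∞` alone makes this function bounded, or makes it vanish at both
ends. Conversely, modulation translates the Fourier side, so the claim for a global pseudomeasure or
pseudofunction is an integral estimate or dominated convergence, and `testFunction_induction` passes
from local to global. -/

noncomputable section

namespace PseudoDist

/-! ### Pairings on vertical lines and the Cauchy–Riemann equation -/

section

/-- The pairing `∫ G(σ + it) φ(t) dt` of `G` on the vertical line `Re s = σ` with `φ`. -/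
def verticalPairing (G : ℂ → ℂ) (σ : ℝ) (φ : ℝ → ℂ) : ℂ :=
  ∫ t : ℝ, G (σ + t * Complex.I) * φ t

/-- A smooth cutoff which is `1` near the compact set `K` and supported in the open set `V`. -/
theorem exists_cutoff {K V : Set ℝ} (hK : IsCompact K) (hV : IsOpen V) (hKV : K ⊆ V) :
    ∃ χ : ℝ → ℂ, ContDiff ℝ ∞ χ ∧ HasCompactSupport χ ∧ tsupport χ ⊆ V ∧
      ∀ᶠ x in 𝓝ˢ K, χ x = 1 := by
  obtain ⟨L, hL, hKL, hLV⟩ := exists_compact_between hK hV hKV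
  obtain ⟨f, hf1, hf0, -⟩ := exists_contMDiffMap_one_nhds_of_subset_interior (n := ⊤)
    (modelWithCornersSelf ℝ ℝ) hK.isClosed hKL
  have hsupp : tsupport (fun x => (f x : ℂ)) ⊆ L := by
    refine closure_minimal (fun x hx => ?_) hL.isClosed
    by_contra hxL
    exact hx (by simp [hf0 x hxL])
  exact ⟨fun x => (f x : ℂ), Complex.ofRealCLM.contDiff.comp f.contMDiff.contDiff,
    hL.of_isClosed_subset (isClosed_tsupport _) hsupp, hsupp.trans hLV,
    hf1.mono fun x hx => by simp [hx]⟩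

variable {G : ℂ → ℂ} {α σ : ℝ}

theorem contDiff_vertical (hG : AnalyticOnNhd ℂ G {s : ℂ | α < s.re}) (hσ : α < σ) :
    ContDiff ℝ ∞ (fun t : ℝ => G (σ + t * Complex.I)) := by
  rw [contDiff_iff_contDiffAt]
  intro t
  have h1 : ContDiffAt ℝ ∞ G (σ + t * Complex.I) :=
    ((hG (σ + t * Complex.I) (by simpa using hσ)).contDiffAt (n := ∞)).restrict_scalars ℝ
  exact h1.comp t (contDiff_const.add (Complex.ofRealCLM.contDiff.mul contDiff_const)).contDiffAt

theorem integrable_vertical_mul (hG : AnalyticOnNhd ℂ G {s : ℂ | α < s.re}) (hσ : α < σ)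
    {φ : ℝ → ℂ} (hφ : Continuous φ) (hc : HasCompactSupport φ) :
    Integrable (fun t : ℝ => G (σ + t * Complex.I) * φ t) :=
  ((contDiff_vertical hG hσ).continuous.mul hφ).integrable_of_hasCompactSupport hc.mul_left

/-- The Cauchy–Riemann equation, integrated by parts against a test function. -/
theorem hasDerivAt_verticalPairing (hG : AnalyticOnNhd ℂ G {s : ℂ | α < s.re}) (hσ : α < σ)
    {φ : ℝ → ℂ} (hφ : ContDiff ℝ ∞ φ) (hc : HasCompactSupport φ) :
    HasDerivAt (fun σ : ℝ => verticalPairing G σ φ)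
      (Complex.I * verticalPairing G σ (deriv φ)) σ := by
  have hG' : AnalyticOnNhd ℂ (deriv G) {s : ℂ | α < s.re} := hG.deriv
  have hparts : ∫ t : ℝ, G (σ + t * Complex.I) * deriv φ t =
      - ∫ t : ℝ, (deriv G (σ + t * Complex.I) * Complex.I) * φ t := by
    refine integral_mul_deriv_eq_deriv_mul_of_integrable (fun t _ => ?_)
      (fun t _ => (hφ.differentiable (by simp) t).hasDerivAt) ?_ ?_ ?_
    · have h1 : HasDerivAt (fun t : ℝ => (σ : ℂ) + t * Complex.I) Complex.I t := by
        simpa using ((Complex.ofRealCLM.hasDerivAt (x := t)).mul_const Complex.I).const_add (σ : ℂ)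
      exact ((hG (σ + t * Complex.I) (by simpa using hσ)).differentiableAt.hasDerivAt).comp t h1
    · exact integrable_vertical_mul hG hσ (hφ.continuous_deriv (by simp)) hc.deriv
    · have := (integrable_vertical_mul hG' hσ hφ.continuous hc).mul_const Complex.I
      exact this.congr (Eventually.of_forall fun t => by simp; ring)
    · exact integrable_vertical_mul hG hσ hφ.continuous hc
  -- A closed strip around `σ` still inside the half-plane: compactness over `tsupport φ` bounds
  -- `deriv G` there and yields the dominating function.
  obtain ⟨δ, hδ, hδσ⟩ : ∃ δ > 0, α < σ - δ := ⟨(σ - α) / 2, by linarith, by linarith⟩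
  have hcont : ContinuousOn (fun p : ℝ × ℝ => deriv G (p.1 + p.2 * Complex.I))
      (Icc (σ - δ) (σ + δ) ×ˢ tsupport φ) := by
    refine hG'.continuousOn.comp (by fun_prop) fun p hp => ?_
    simpa using hδσ.trans_le hp.1.1
  obtain ⟨C, hC⟩ := (isCompact_Icc.prod hc).exists_bound_of_continuousOn hcont
  have hderiv := (hasDerivAt_integral_of_dominated_loc_of_deriv_le (μ := volume)
    (F := fun (x : ℝ) (t : ℝ) => G (x + t * Complex.I) * φ t)
    (F' := fun (x : ℝ) (t : ℝ) => deriv G (x + t * Complex.I) * φ t)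
    (bound := fun t => C * ‖φ t‖) (s := Icc (σ - δ) (σ + δ)) (x₀ := σ)
    (Icc_mem_nhds (by linarith) (by linarith)) ?_
    (integrable_vertical_mul hG hσ hφ.continuous hc)
    (integrable_vertical_mul hG' hσ hφ.continuous hc).aestronglyMeasurable ?_ ?_ ?_).2
  · have h2 : Complex.I * verticalPairing G σ (deriv φ) =
        ∫ t : ℝ, deriv G (σ + t * Complex.I) * φ t := by
      rw [verticalPairing, hparts, ← integral_neg, ← integral_const_mul]
      refine integral_congr_ae (Eventually.of_forall fun t => ?_)
      linear_combination (-(deriv G (σ + t * Complex.I) * φ t)) * Complex.I_mul_I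
    rw [h2]
    exact hderiv
  · filter_upwards [lt_mem_nhds hσ] with x hx
    exact (integrable_vertical_mul hG hx hφ.continuous hc).aestronglyMeasurable
  · refine Eventually.of_forall fun t x hx => ?_
    by_cases ht : t ∈ tsupport φ
    · rw [norm_mul]
      exact mul_le_mul_of_nonneg_right (hC (x, t) ⟨hx, ht⟩) (norm_nonneg _)
    · simp [image_eq_zero_of_notMem_tsupport ht]
  · exact ((hφ.continuous.integrable_of_hasCompactSupport hc).norm).const_mul C
  · refine Eventually.of_forall fun t x hx => ?_
    have h1 : HasDerivAt (fun x : ℝ => (x : ℂ) + t * Complex.I) 1 x := by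
      simpa using (Complex.ofRealCLM.hasDerivAt (x := x)).add_const (t * Complex.I)
    have h3 := ((hG (x + t * Complex.I)
      (by simpa using hδσ.trans_le hx.1)).differentiableAt.hasDerivAt).comp x h1
    simpa using h3.mul_const (φ t)

variable {U : Opens ℝ} {g : 𝓓(U, ℂ) →L[ℂ] ℂ}

/-- Near `α` the existence of the boundary limit bounds the pairing; on the remaining compact range
of `σ` continuity does. This is the pointwise bound fed to Banach–Steinhaus. -/
theorem IsBoundaryValue.exists_norm_le (hG : AnalyticOnNhd ℂ G {s : ℂ | α < s.re})
    (hg : IsBoundaryValue G α g) (φ : 𝓓(U, ℂ)) :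
    ∃ C, ∀ σ ∈ Ioc α (α + 1), ‖verticalPairing G σ φ‖ ≤ C := by
  have h0 : ∀ᶠ σ in 𝓝[>] α, ‖verticalPairing G σ φ‖ < ‖g φ‖ + 1 :=
    (hg φ).norm.eventually_lt_const (by linarith)
  obtain ⟨b, hb, hαb⟩ := (mem_nhdsGT_iff_exists_Ioo_subset).1 h0
  obtain ⟨C, hC⟩ := (isCompact_Icc (a := b) (b := α + 1)).exists_bound_of_continuousOn
    (f := fun σ => verticalPairing G σ φ) fun σ hσ =>
      (hasDerivAt_verticalPairing hG ((show α < b from hb).trans_le hσ.1) φ.contDiff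
        φ.hasCompactSupport).continuousAt.continuousWithinAt
  refine ⟨max (‖g φ‖ + 1) C, fun σ hσ => ?_⟩
  rcases lt_or_ge σ b with h | h
  · exact (le_of_lt (hαb ⟨hσ.1, h⟩)).trans (le_max_left _ _)
  · exact (hC σ ⟨h, hσ.2⟩).trans (le_max_right _ _)

end

/-! ### Uniform boundedness and polynomial growth in the frequency -/

section

theorem iteratedDeriv_const_mul_cexp (c : ℂ) (h : ℝ) (k : ℕ) :
    iteratedDeriv k (fun t : ℝ => c * Complex.exp (Complex.I * h * t)) =
      fun t : ℝ => c * (Complex.I * h) ^ k * Complex.exp (Complex.I * h * t) := by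
  induction k with
  | zero => simp
  | succ k ih =>
    rw [iteratedDeriv_succ, ih]
    funext t
    have h1 : HasDerivAt (fun t : ℝ => Complex.I * h * t) (Complex.I * h) t := by
      simpa using (Complex.ofRealCLM.hasDerivAt (x := t)).const_mul (Complex.I * (h : ℂ))
    rw [(h1.cexp.const_mul (c * (Complex.I * h) ^ k)).deriv]
    ring

theorem norm_cexp_I_mul (h t : ℝ) : ‖Complex.exp (Complex.I * h * t)‖ = 1 := by
  have : Complex.I * h * t = ((h * t : ℝ) : ℂ) * Complex.I := by push_cast; ring
  rw [this, Complex.norm_exp_ofReal_mul_I]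

theorem contDiff_tsum_cexp {c : ℕ → ℂ} {h : ℕ → ℝ}
    (hc : ∀ k : ℕ, Summable fun n => ‖c n‖ * |h n| ^ k) :
    ContDiff ℝ ∞ (fun t : ℝ => ∑' n, c n * Complex.exp (Complex.I * h n * t)) := by
  refine contDiff_tsum (N := ⊤) (v := fun k n => ‖c n‖ * |h n| ^ k) (fun n => ?_)
    (fun k _ => hc k) (fun k n t _ => ?_)
  · exact contDiff_const.mul (contDiff_const.mul Complex.ofRealCLM.contDiff).cexp
  · rw [norm_iteratedFDeriv_eq_norm_iteratedDeriv, iteratedDeriv_const_mul_cexp]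
    simp [norm_cexp_I_mul]

theorem summable_mul_cexp {c : ℕ → ℂ} {h : ℕ → ℝ} (hc : Summable fun n => ‖c n‖) (t : ℝ) :
    Summable fun n => c n * Complex.exp (Complex.I * h n * t) :=
  Summable.of_norm (by simpa [norm_cexp_I_mul] using hc)

/-- Uniform boundedness: if a family of continuous functions defines functionals which are pointwise
bounded on all the rapidly converging exponential series, then these functionals are polynomially
bounded on the exponentials. -/
theorem exists_polynomial_bound_of_series {ι : Type*} {F : ι → ℝ → ℂ}
    (hF : ∀ i, Integrable (F i))
    (hbdd : ∀ (c : ℕ → ℂ) (h : ℕ → ℝ), (∀ k : ℕ, Summable fun n => ‖c n‖ * |h n| ^ k) →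
      ∃ C, ∀ i, ‖∫ t, F i t * ∑' n, c n * Complex.exp (Complex.I * h n * t)‖ ≤ C) :
    ∃ (C : ℝ) (N : ℕ), ∀ i (h : ℝ),
      ‖∫ t : ℝ, F i t * Complex.exp (Complex.I * h * t)‖ ≤ C * (1 + |h|) ^ N := by
  by_contra! hcon
  choose i h hi using fun n : ℕ => hcon (4 ^ n) n
  set r : ℕ → ℝ := fun n => (2⁻¹) ^ n * ((1 + |h n|) ^ n)⁻¹ with hr
  have hr0 : ∀ n, 0 < r n := fun n => by positivity
  have hrk : ∀ k : ℕ, Summable fun n => r n * |h n| ^ k := fun k => by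
    refine Summable.of_norm_bounded_eventually_nat (g := fun n : ℕ => (2⁻¹ : ℝ) ^ n)
      (summable_geometric_of_lt_one (by norm_num) (by norm_num)) ?_
    filter_upwards [eventually_ge_atTop k] with n hn
    rw [Real.norm_of_nonneg (by have := hr0 n; positivity), hr]
    have h1 : |h n| ^ k ≤ (1 + |h n|) ^ n :=
      (pow_le_pow_left₀ (abs_nonneg _) (by linarith) k).trans
        (pow_le_pow_right₀ (by linarith [abs_nonneg (h n)]) hn)
    have h2 : ((1 + |h n|) ^ n)⁻¹ * |h n| ^ k ≤ 1 := by
      rw [inv_mul_le_iff₀ (by positivity)]; simpa using h1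
    calc (2⁻¹ : ℝ) ^ n * ((1 + |h n|) ^ n)⁻¹ * |h n| ^ k
        = (2⁻¹ : ℝ) ^ n * (((1 + |h n|) ^ n)⁻¹ * |h n| ^ k) := by ring
      _ ≤ (2⁻¹ : ℝ) ^ n * 1 := by gcongr
      _ = _ := mul_one _
  have hrs : Summable r := by simpa using hrk 0
  have hbk : ∀ (b : BoundedContinuousFunction ℕ ℂ) (k : ℕ),
      Summable fun n => ‖b n * (r n : ℂ)‖ * |h n| ^ k := fun b k => by
    refine Summable.of_nonneg_of_le (fun n => by positivity) (fun n => ?_)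
      ((hrk k).mul_left ‖b‖)
    rw [norm_mul, Complex.norm_of_nonneg (hr0 n).le, mul_assoc]
    have := hr0 n
    gcongr
    exact b.norm_coe_le_norm n
  have hb0 : ∀ b : BoundedContinuousFunction ℕ ℂ, Summable fun n => ‖b n * (r n : ℂ)‖ :=
    fun b => by simpa using hbk b 0
  set S : BoundedContinuousFunction ℕ ℂ → ℝ → ℂ :=
    fun b t => ∑' n, (b n * (r n : ℂ)) * Complex.exp (Complex.I * h n * t) with hS
  have hSle : ∀ b t, ‖S b t‖ ≤ ‖b‖ * ∑' n, r n := fun b t => by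
    refine tsum_of_norm_bounded (hrs.hasSum.mul_left ‖b‖) fun n => ?_
    rw [norm_mul, norm_cexp_I_mul, mul_one, norm_mul, Complex.norm_of_nonneg (hr0 n).le]
    exact mul_le_mul_of_nonneg_right (b.norm_coe_le_norm n) (hr0 n).le
  have hSint : ∀ b i, Integrable fun t => F i t * S b t := fun b i =>
    (hF i).mul_bdd (c := ‖b‖ * ∑' n, r n)
      (contDiff_tsum_cexp (hbk b)).continuous.aestronglyMeasurable
      (Eventually.of_forall (hSle b))
  -- Bounded sequences of coefficients form a Banach space, so uniform boundedness applies without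
  -- any topology on the test functions.
  let T : ι → BoundedContinuousFunction ℕ ℂ →L[ℂ] ℂ := fun i =>
    LinearMap.mkContinuous
      { toFun := fun b => ∫ t, F i t * S b t
        map_add' := fun b b' => by
          rw [← integral_add (hSint b i) (hSint b' i)]
          refine integral_congr_ae (Eventually.of_forall fun t => ?_)
          simp only [hS]
          rw [← mul_add, ← (summable_mul_cexp (hb0 b) t).tsum_add (summable_mul_cexp (hb0 b') t)]
          congr 1
          exact tsum_congr fun n => by simp; ring
        map_smul' := fun a b => by
          rw [RingHom.id_apply, smul_eq_mul, ← integral_const_mul]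
          refine integral_congr_ae (Eventually.of_forall fun t => ?_)
          have h1 : S (a • b) t = a * S b t := by
            simp only [hS]
            rw [← tsum_mul_left]
            exact tsum_congr fun n => by simp; ring
          simp only [h1]
          ring }
      ((∫ t, ‖F i t‖) * ∑' n, r n) fun b => by
        refine (norm_integral_le_of_norm_le ((hF i).norm.mul_const (‖b‖ * ∑' n, r n))
          (Eventually.of_forall fun t => ?_)).trans_eq ?_
        · rw [norm_mul]
          exact mul_le_mul_of_nonneg_left (hSle b t) (norm_nonneg _)
        · rw [integral_mul_const]; ring
  obtain ⟨C, hC⟩ := banach_steinhaus (g := T) fun b => hbdd _ _ (hbk b)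
  have hkey : ∀ n : ℕ, (2 : ℝ) ^ n ≤ C := fun n => by
    -- The `n`-th unit sequence isolates a single exponential.
    let e : BoundedContinuousFunction ℕ ℂ :=
      BoundedContinuousFunction.ofNormedAddCommGroup (Pi.single n 1)
        continuous_of_discreteTopology 1 fun m => by
          rcases eq_or_ne m n with rfl | hm
          · simp
          · simp [Pi.single_eq_of_ne hm]
    have he : ‖e‖ ≤ 1 := BoundedContinuousFunction.norm_ofNormedAddCommGroup_le _ zero_le_one _
    have hTe : T (i n) e = r n * ∫ t : ℝ, F (i n) t * Complex.exp (Complex.I * h n * t) := by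
      change ∫ t, F (i n) t * S e t = _
      rw [← integral_const_mul]
      refine integral_congr_ae (Eventually.of_forall fun t => ?_)
      have h1 : S e t = r n * Complex.exp (Complex.I * h n * t) := by
        simp only [hS]
        rw [tsum_eq_single n fun m hm => by simp [e, Pi.single_eq_of_ne hm]]
        simp [e]
      simp only [h1]
      ring
    have h2 : ‖T (i n) e‖ ≤ C :=
      ((T (i n)).le_of_opNorm_le (hC _) e).trans
        (mul_le_of_le_one_right ((norm_nonneg _).trans (hC (i n))) he)
    rw [hTe, norm_mul, Complex.norm_of_nonneg (hr0 n).le] at h2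
    refine le_trans ?_ h2
    calc (2 : ℝ) ^ n = r n * (4 ^ n * (1 + |h n|) ^ n) := by
          have h3 : (1 + |h n|) ^ n ≠ 0 := by positivity
          rw [hr]
          field_simp
          rw [← mul_pow]; norm_num
      _ ≤ _ := mul_le_mul_of_nonneg_left (hi n).le (hr0 n).le
  obtain ⟨n, hn⟩ := pow_unbounded_of_one_lt C (one_lt_two)
  exact absurd (hkey n) (not_le.2 hn)

variable {G : ℂ → ℂ} {α : ℝ} {U : Opens ℝ} {g : 𝓓(U, ℂ) →L[ℂ] ℂ}

/-- The pairings of `G` with the modulated test functions `e^{iht} χ(t)` grow at most polynomially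
in `h`, uniformly up to the boundary. -/
theorem IsBoundaryValue.exists_polynomial_bound (hG : AnalyticOnNhd ℂ G {s : ℂ | α < s.re})
    (hg : IsBoundaryValue G α g) (χ : 𝓓(U, ℂ)) :
    ∃ (C : ℝ) (N : ℕ), ∀ σ ∈ Ioc α (α + 1), ∀ h : ℝ,
      ‖verticalPairing G σ (modulate h χ)‖ ≤ C * (1 + |h|) ^ N := by
  obtain ⟨C, N, hCN⟩ := exists_polynomial_bound_of_series (ι := Ioc α (α + 1))
    (F := fun σ t => G ((σ : ℝ) + t * Complex.I) * χ t)
    (fun σ => integrable_vertical_mul hG σ.2.1 χ.continuous χ.hasCompactSupport)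
    (fun c h hc => by
      -- The series is smooth, so its product with `χ` is one admissible test function.
      let ψ : 𝓓(U, ℂ) :=
        ⟨fun t => χ t * ∑' n, c n * Complex.exp (Complex.I * h n * t),
          χ.contDiff.mul (contDiff_tsum_cexp hc), χ.hasCompactSupport.mul_right,
          tsupport_mul_subset_left.trans χ.tsupport_subset⟩
      obtain ⟨C, hC⟩ := hg.exists_norm_le hG ψ
      refine ⟨C, fun σ => (le_of_eq ?_).trans (hC σ σ.2)⟩
      congr 1
      refine integral_congr_ae (Eventually.of_forall fun t => ?_)
      change _ = G _ * (χ t * _)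
      ring)
  refine ⟨C, N, fun σ hσ h => (le_of_eq ?_).trans (hCN ⟨σ, hσ⟩ h)⟩
  congr 1
  refine integral_congr_ae (Eventually.of_forall fun t => ?_)
  simp only [modulate_apply]
  ring

end

/-! ### Fourier expansion and a common order of growth -/

section

/-- The multiplication formula (Fubini) for `F` and `𝓕⁻ ψ`, combined with Fourier inversion for `ψ`.
-/
theorem integral_fourierInv_mul_eq {F : ℝ → ℂ} (hF : Integrable F) (ψ : 𝓢(ℝ, ℂ)) :
    ∫ ξ : ℝ, 𝓕⁻ ψ ξ * ∫ t : ℝ, Complex.exp (Complex.I * (-(2 * Real.pi * ξ) : ℝ) * t) * F t =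
      ∫ t : ℝ, F t * ψ t := by
  have h1 := VectorFourier.integral_fourierIntegral_smul_eq_flip (L := innerₗ ℝ) (μ := volume)
    (ν := volume) Real.continuous_fourierChar continuous_inner hF (𝓕⁻ ψ).integrable
  rw [flip_innerₗ] at h1
  have h2 : ∀ t, VectorFourier.fourierIntegral Real.fourierChar volume (innerₗ ℝ)
      (𝓕⁻ ψ : 𝓢(ℝ, ℂ)) t = ψ t := fun t => by
    have h3 : 𝓕 (𝓕⁻ ψ : 𝓢(ℝ, ℂ)) = ψ := by simp
    change 𝓕 (𝓕⁻ ψ : 𝓢(ℝ, ℂ)) t = ψ t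
    rw [h3]
  simp only [h2, smul_eq_mul] at h1
  rw [← h1]
  refine integral_congr_ae (Eventually.of_forall fun ξ => ?_)
  change _ = (𝓕 F : ℝ → ℂ) ξ * (𝓕⁻ ψ : 𝓢(ℝ, ℂ)) ξ
  refine (congrArg (fun z => 𝓕⁻ ψ ξ * z) ?_).trans (mul_comm _ _)
  rw [Real.fourier_real_eq_integral_exp_smul]
  refine integral_congr_ae (Eventually.of_forall fun t => ?_)
  simp only [smul_eq_mul]
  congr 2
  push_cast
  ring

theorem integrable_norm_mul_one_add_pow (ψ : 𝓢(ℝ, ℂ)) (a : ℝ) (N : ℕ) :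
    Integrable fun ξ : ℝ => ‖ψ ξ‖ * (1 + |a * ξ|) ^ N := by
  have h1 : Integrable fun ξ : ℝ =>
      2 ^ (N - 1) * (‖ψ ξ‖ + |a| ^ N * (‖ξ‖ ^ N * ‖ψ ξ‖)) :=
    ((ψ.integrable.norm).add ((ψ.integrable_pow_mul volume N).const_mul _)).const_mul _
  refine h1.mono' ((ψ.continuous.norm.mul (by fun_prop)).aestronglyMeasurable)
    (Eventually.of_forall fun ξ => ?_)
  rw [Real.norm_of_nonneg (by positivity)]
  calc ‖ψ ξ‖ * (1 + |a * ξ|) ^ N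
      ≤ ‖ψ ξ‖ * (2 ^ (N - 1) * (1 ^ N + |a * ξ| ^ N)) := by
        gcongr; exact add_pow_le zero_le_one (abs_nonneg _) N
    _ = _ := by rw [abs_mul, mul_pow, Real.norm_eq_abs]; ring

variable {G : ℂ → ℂ} {α σ : ℝ} {U : Opens ℝ} {g : 𝓓(U, ℂ) →L[ℂ] ℂ}

theorem continuous_verticalPairing_modulate (hG : AnalyticOnNhd ℂ G {s : ℂ | α < s.re})
    (hσ : α < σ) (φ : 𝓓(U, ℂ)) :
    Continuous fun h : ℝ => verticalPairing G σ (modulate h φ) := by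
  refine continuous_of_dominated (bound := fun t => ‖G (σ + t * Complex.I) * φ t‖)
    (fun h => (integrable_vertical_mul hG hσ (modulate h φ).continuous
      (modulate h φ).hasCompactSupport).aestronglyMeasurable)
    (fun h => Eventually.of_forall fun t => ?_)
    (integrable_vertical_mul hG hσ φ.continuous φ.hasCompactSupport).norm
    (Eventually.of_forall fun t => ?_)
  · rw [modulate_apply, norm_mul, norm_mul, norm_mul, norm_cexp_I_mul, one_mul]
  · simp only [modulate_apply]
    fun_prop

/-- Multiplying by `ψ` superposes modulations, so everything supported where `χ = 1` is controlled
by the modulations of `χ` alone. -/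
theorem verticalPairing_mul_eq_integral (hG : AnalyticOnNhd ℂ G {s : ℂ | α < s.re})
    (hσ : α < σ) (χ : 𝓓(U, ℂ)) (ψ : 𝓢(ℝ, ℂ)) (h : ℝ) :
    verticalPairing G σ (fun t => Complex.exp (Complex.I * h * t) * (χ t * ψ t)) =
      ∫ ξ : ℝ, 𝓕⁻ ψ ξ * verticalPairing G σ (modulate (h - 2 * Real.pi * ξ) χ) := by
  have h1 := integral_fourierInv_mul_eq (integrable_vertical_mul hG hσ (modulate h χ).continuous
    (modulate h χ).hasCompactSupport) ψ
  simp only [modulate_apply] at h1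
  rw [verticalPairing]
  calc _ = _ := integral_congr_ae (Eventually.of_forall fun t => by
                  ring)
    _ = _ := h1.symm
    _ = _ := by
      refine integral_congr_ae (Eventually.of_forall fun ξ => ?_)
      simp only [verticalPairing, modulate_apply]
      congr 1
      refine integral_congr_ae (Eventually.of_forall fun t => ?_)
      simp only
      rw [mul_left_comm, ← mul_assoc (Complex.exp _) (Complex.exp _), ← Complex.exp_add]
      congr 3
      push_cast
      ring

/-- The order of polynomial growth can be chosen uniformly for all test functions supported where
`χ = 1`. -/
theorem IsBoundaryValue.exists_uniform_order (hG : AnalyticOnNhd ℂ G {s : ℂ | α < s.re})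
    (hg : IsBoundaryValue G α g) (χ : 𝓓(U, ℂ)) :
    ∃ N : ℕ, ∀ φ : 𝓓(U, ℂ), (∀ t ∈ tsupport φ, χ t = 1) → ∃ C : ℝ, 0 ≤ C ∧
      ∀ σ ∈ Ioc α (α + 1), ∀ h : ℝ,
        ‖verticalPairing G σ (modulate h φ)‖ ≤ C * (1 + |h|) ^ N := by
  obtain ⟨C, N, hC⟩ := hg.exists_polynomial_bound hG χ
  have hC0 : 0 ≤ C := by
    have := (norm_nonneg _).trans (hC (α + 1) ⟨by linarith, le_rfl⟩ 0)
    simpa using this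
  refine ⟨N, fun φ hφ => ?_⟩
  set ψ := toSchwartz φ
  set w := fun ξ : ℝ => ‖𝓕⁻ ψ ξ‖ * (1 + |2 * Real.pi * ξ|) ^ N with hw
  have hwi : Integrable w := integrable_norm_mul_one_add_pow (𝓕⁻ ψ) (2 * Real.pi) N
  refine ⟨C * ∫ ξ, w ξ, mul_nonneg hC0 (integral_nonneg fun ξ => by positivity),
    fun σ hσ h => ?_⟩
  have h1 : verticalPairing G σ (modulate h φ) =
      ∫ ξ : ℝ, 𝓕⁻ ψ ξ * verticalPairing G σ (modulate (h - 2 * Real.pi * ξ) χ) := by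
    rw [← verticalPairing_mul_eq_integral hG hσ.1]
    congr 1
    funext t
    rw [modulate_apply, toSchwartz_apply]
    by_cases ht : t ∈ tsupport φ
    · rw [hφ t ht, one_mul]
    · simp [image_eq_zero_of_notMem_tsupport ht]
  rw [h1]
  refine (norm_integral_le_of_norm_le ((hwi.const_mul C).mul_const ((1 + |h|) ^ N))
    (Eventually.of_forall fun ξ => ?_)).trans_eq (by rw [integral_mul_const, integral_const_mul])
  rw [norm_mul]
  -- A Peetre-type inequality separates `h` from `ξ`; the `ξ`-factor is absorbed by the rapid decay
  -- of `𝓕⁻ ψ`.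
  have h2 : 1 + |h - 2 * Real.pi * ξ| ≤ (1 + |2 * Real.pi * ξ|) * (1 + |h|) := by
    have := abs_sub h (2 * Real.pi * ξ)
    nlinarith [mul_nonneg (abs_nonneg h) (abs_nonneg (2 * Real.pi * ξ))]
  calc ‖𝓕⁻ ψ ξ‖ * ‖verticalPairing G σ (modulate (h - 2 * Real.pi * ξ) χ)‖
      ≤ ‖𝓕⁻ ψ ξ‖ * (C * (1 + |h - 2 * Real.pi * ξ|) ^ N) := by gcongr; exact hC σ hσ _
    _ ≤ ‖𝓕⁻ ψ ξ‖ * (C * ((1 + |2 * Real.pi * ξ|) * (1 + |h|)) ^ N) := by gcongr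
    _ = _ := by rw [hw, mul_pow]; ring

end

/-! ### Rapid decay as `h → -∞` -/

section

/-- Backward estimate for the equation `f' = -h f + w` with `h < 0`. -/
theorem norm_le_of_hasDerivAt_neg_mul {f w : ℝ → ℂ} {a b h M : ℝ} (hab : a ≤ b) (hh : h < 0)
    (hf : ∀ x ∈ Icc a b, HasDerivAt f (-h * f x + w x) x) (hw : ∀ x ∈ Icc a b, ‖w x‖ ≤ M) :
    ‖f a‖ ≤ ‖f b‖ + M / |h| := by
  have hM : 0 ≤ M := (norm_nonneg _).trans (hw a (left_mem_Icc.2 hab))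
  -- Integrating factor: it cancels the term `-h f`, equals `1` at `a`, and stays at most `1` on
  -- `[a, b]` because `h < 0`.
  set e : ℝ → ℝ := fun x => Real.exp (h * (x - a)) with he
  have hed : ∀ x, HasDerivAt e (h * e x) x := fun x => by
    have h1 := (((hasDerivAt_id x).sub_const a).const_mul h).exp
    simpa [he, mul_comm] using h1
  set u : ℝ → ℂ := fun x => (e x : ℂ) * f x - f a with hu
  have hud : ∀ x ∈ Icc a b, HasDerivAt u ((e x : ℂ) * w x) x := fun x hx => by
    have h1 := (((hed x).ofReal_comp).mul (hf x hx)).sub_const (f a)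
    refine h1.congr_deriv ?_
    push_cast
    ring
  -- An explicit primitive of `M * e`, vanishing at `a`; it majorizes `‖u‖` and never exceeds `M /
  -- |h|`.
  have hBd : ∀ x, HasDerivAt (fun x => M / h * (e x - 1)) (M * e x) x := fun x => by
    refine (((hed x).sub_const 1).const_mul (M / h)).congr_deriv ?_
    have := hh.ne
    field_simp
  have hbound := image_norm_le_of_norm_deriv_right_le_deriv_boundary (f := u)
    (fun x hx => (hud x hx).continuousAt.continuousWithinAt)
    (fun x hx => (hud x (Ico_subset_Icc_self hx)).hasDerivWithinAt) (by simp [hu, he]) hBd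
    (fun x hx => by
      rw [norm_mul, Complex.norm_of_nonneg (Real.exp_pos _).le, mul_comm]
      exact mul_le_mul_of_nonneg_right (hw x (Ico_subset_Icc_self hx)) (Real.exp_pos _).le)
    (right_mem_Icc.2 hab)
  have he0 : 0 ≤ e b := (Real.exp_pos _).le
  have he1 : e b ≤ 1 := Real.exp_le_one_iff.2 (mul_nonpos_of_nonpos_of_nonneg hh.le (by linarith))
  have h2 : M / h * (e b - 1) ≤ M / |h| := by
    have : M / h * (e b - 1) = M / |h| * (1 - e b) := by rw [abs_of_neg hh]; field_simp; ring
    rw [this]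
    exact mul_le_of_le_one_right (by positivity) (by linarith)
  have h3 : ‖f a‖ ≤ ‖(e b : ℂ) * f b‖ + ‖u b‖ := by
    have : f a = (e b : ℂ) * f b - u b := by simp [hu]
    rw [this]
    exact norm_sub_le _ _
  have h4 : ‖(e b : ℂ) * f b‖ ≤ ‖f b‖ := by
    rw [norm_mul, Complex.norm_of_nonneg he0]
    exact mul_le_of_le_one_left (norm_nonneg _) he1
  linarith

variable {G : ℂ → ℂ} {α σ : ℝ} {U : Opens ℝ} {g : 𝓓(U, ℂ) →L[ℂ] ℂ}

/-- The derivative of a test function on `U`, as a test function on `U`. -/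
def derivTest (φ : 𝓓(U, ℂ)) : 𝓓(U, ℂ) where
  toFun := deriv φ
  contDiff' := by
    have h1 : ContDiff ℝ (∞ + 1) φ := φ.contDiff
    exact (contDiff_succ_iff_deriv.1 h1).2.2
  hasCompactSupport' := φ.hasCompactSupport.deriv
  tsupport_subset' := (tsupport_deriv_subset).trans φ.tsupport_subset

theorem coe_derivTest (φ : 𝓓(U, ℂ)) : ⇑(derivTest φ) = deriv φ := rfl

theorem hasDerivAt_verticalPairing_modulate (hG : AnalyticOnNhd ℂ G {s : ℂ | α < s.re})
    (hσ : α < σ) (φ : 𝓓(U, ℂ)) (h : ℝ) :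
    HasDerivAt (fun σ : ℝ => verticalPairing G σ (modulate h φ))
      (-h * verticalPairing G σ (modulate h φ) +
        Complex.I * verticalPairing G σ (modulate h (derivTest φ))) σ := by
  refine (hasDerivAt_verticalPairing hG hσ (modulate h φ).contDiff
    (modulate h φ).hasCompactSupport).congr_deriv ?_
  have h1 : ∀ t, deriv (modulate h φ) t =
      Complex.I * h * modulate h φ t + modulate h (derivTest φ) t := fun t => by
    have h2 : HasDerivAt (fun t : ℝ => Complex.I * h * t) (Complex.I * h) t := by
      simpa using (Complex.ofRealCLM.hasDerivAt (x := t)).const_mul (Complex.I * (h : ℂ))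
    have h3 := h2.cexp.mul ((φ.contDiff.differentiable (by simp)) t).hasDerivAt
    rw [show deriv (modulate h φ) t = _ from h3.deriv, modulate_apply, modulate_apply,
      coe_derivTest]
    ring
  have h2 : verticalPairing G σ (deriv (modulate h φ)) =
      Complex.I * h * verticalPairing G σ (modulate h φ) +
        verticalPairing G σ (modulate h (derivTest φ)) := by
    simp only [verticalPairing]
    rw [← integral_const_mul, ← integral_add
      ((integrable_vertical_mul hG hσ (modulate h φ).continuous
        (modulate h φ).hasCompactSupport).const_mul _)
      (integrable_vertical_mul hG hσ (modulate h (derivTest φ)).continuous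
        (modulate h (derivTest φ)).hasCompactSupport)]
    refine integral_congr_ae (Eventually.of_forall fun t => ?_)
    simp only [h1]
    ring
  rw [h2]
  linear_combination (h * verticalPairing G σ (modulate h φ)) * Complex.I_mul_I

/-- On a line inside the half-plane, the pairings with modulated test functions decay rapidly. -/
theorem exists_rapid_decay (hG : AnalyticOnNhd ℂ G {s : ℂ | α < s.re}) (hσ : α < σ)
    (φ : 𝓓(U, ℂ)) (m : ℕ) :
    ∃ C : ℝ, 0 ≤ C ∧ ∀ h : ℝ, ‖verticalPairing G σ (modulate h φ)‖ * |h| ^ m ≤ C := by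
  let F : 𝓢(ℝ, ℂ) := HasCompactSupport.toSchwartzMap
    (f := fun t : ℝ => G (σ + t * Complex.I) * φ t) φ.hasCompactSupport.mul_left
    ((contDiff_vertical hG hσ).mul φ.contDiff)
  obtain ⟨C, hC0, hC⟩ := (𝓕 F).decay m 0
  refine ⟨(2 * Real.pi) ^ m * C, by positivity, fun h => ?_⟩
  have h1 := hC (-(h / (2 * Real.pi)))
  have h2 : verticalPairing G σ (modulate h φ) = 𝓕 F (-(h / (2 * Real.pi))) := by
    rw [SchwartzMap.fourier_coe, Real.fourier_real_eq_integral_exp_smul]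
    refine integral_congr_ae (Eventually.of_forall fun t => ?_)
    change G _ * modulate h φ t = _ • (G _ * φ t)
    rw [modulate_apply, smul_eq_mul, mul_left_comm]
    congr 2
    have := Real.pi_ne_zero
    push_cast
    field_simp
  rw [norm_iteratedFDeriv_zero, ← h2, norm_neg, Real.norm_eq_abs, abs_div,
    abs_of_pos (show 0 < 2 * Real.pi by positivity), div_pow, div_mul_eq_mul_div,
    div_le_iff₀ (by positivity)] at h1
  linarith

/-- The pairings with `e^{iht} φ(t)` decay rapidly as `h → -∞`, uniformly up to the boundary. -/
theorem IsBoundaryValue.exists_uniform_decay (hG : AnalyticOnNhd ℂ G {s : ℂ | α < s.re})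
    (hg : IsBoundaryValue G α g) (φ : 𝓓(U, ℂ)) (n : ℕ) :
    ∃ C : ℝ, ∀ σ ∈ Ioc α (α + 1), ∀ h ≤ (-1 : ℝ),
      ‖verticalPairing G σ (modulate h φ)‖ * |h| ^ n ≤ C := by
  obtain ⟨f, hf1, hf2, hf3, hf4⟩ := exists_cutoff φ.hasCompactSupport U.isOpen φ.tsupport_subset
  let χ : 𝓓(U, ℂ) := ⟨f, hf1, hf2, hf3⟩
  have hχ : ∀ t ∈ tsupport φ, χ t = 1 := fun t ht => hf4.self_of_nhdsSet t ht
  obtain ⟨N, hN⟩ := hg.exists_uniform_order hG χ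
  -- Here `N` is fixed before `φ` and `m`. The support condition passes to `derivTest φ`, so the
  -- induction never raises the order.
  have key : ∀ (m : ℕ) (φ : 𝓓(U, ℂ)), (∀ t ∈ tsupport φ, χ t = 1) → ∃ C : ℝ, 0 ≤ C ∧
      ∀ σ ∈ Ioc α (α + 1), ∀ h ≤ (-1 : ℝ),
        ‖verticalPairing G σ (modulate h φ)‖ * |h| ^ m ≤ C * |h| ^ N := by
    intro m
    induction m with
    | zero =>
      intro φ hφ
      obtain ⟨C, hC0, hC⟩ := hN φ hφ
      refine ⟨C * 2 ^ N, by positivity, fun σ hσ h hh => ?_⟩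
      have h1 : 1 ≤ |h| := by rw [abs_of_neg (by linarith)]; linarith
      calc _ = ‖verticalPairing G σ (modulate h φ)‖ := by simp
        _ ≤ C * (1 + |h|) ^ N := hC σ hσ h
        _ ≤ C * (2 * |h|) ^ N := by gcongr; linarith
        _ = _ := by rw [mul_pow]; ring
    | succ m ih =>
      intro φ hφ
      obtain ⟨K, hK0, hK⟩ := ih (derivTest φ) fun t ht => hφ t (tsupport_deriv_subset ht)
      obtain ⟨A, hA0, hA⟩ := exists_rapid_decay hG (lt_add_one α) φ (m + 1)
      refine ⟨A + K, by positivity, fun σ hσ h hh => ?_⟩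
      have h1 : 1 ≤ |h| := by rw [abs_of_neg (by linarith)]; linarith
      -- `M` is the inductive bound for the derivative; dividing it by `|h|` supplies exactly the
      -- extra power.
      have h2 := norm_le_of_hasDerivAt_neg_mul (f := fun σ => verticalPairing G σ (modulate h φ))
        (w := fun σ => Complex.I * verticalPairing G σ (modulate h (derivTest φ)))
        (M := K * |h| ^ N / |h| ^ m) hσ.2 (show h < 0 by linarith)
        (fun x hx => hasDerivAt_verticalPairing_modulate hG (hσ.1.trans_le hx.1) φ h)
        (fun x hx => by
          rw [norm_mul, Complex.norm_I, one_mul, le_div_iff₀ (by positivity)]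
          exact hK x ⟨hσ.1.trans_le hx.1, hx.2⟩ h hh)
      calc _ ≤ (‖verticalPairing G (α + 1) (modulate h φ)‖ + K * |h| ^ N / |h| ^ m / |h|)
              * |h| ^ (m + 1) := by gcongr
        _ = ‖verticalPairing G (α + 1) (modulate h φ)‖ * |h| ^ (m + 1) + K * |h| ^ N := by
            have : |h| ≠ 0 := by positivity
            field_simp
            ring
        _ ≤ A * |h| ^ N + K * |h| ^ N := by
            exact add_le_add ((hA h).trans (le_mul_of_one_le_right hA0 (one_le_pow₀ h1))) le_rfl
        _ = _ := by ring
  -- The surplus `N` powers cancel the polynomial growth.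
  obtain ⟨C, -, hC⟩ := key (n + N) φ hχ
  refine ⟨C, fun σ hσ h hh => ?_⟩
  have h1 : 0 < |h| ^ N := by
    have : 0 < |h| := abs_pos.2 (by linarith)
    positivity
  have h2 := hC σ hσ h hh
  rw [pow_add, ← mul_assoc] at h2
  exact le_of_mul_le_mul_right h2 h1

theorem IsBoundaryValue.tendsto_modulate (hg : IsBoundaryValue G α g) (φ : 𝓓(U, ℂ)) (h : ℝ) :
    Tendsto (fun σ : ℝ => verticalPairing G σ (modulate h φ)) (𝓝[>] α) (𝓝 (g (modulate h φ))) :=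
  hg (modulate h φ)

theorem IsBoundaryValue.isBigO_atBot (hG : AnalyticOnNhd ℂ G {s : ℂ | α < s.re})
    (hg : IsBoundaryValue G α g) (φ : 𝓓(U, ℂ)) (n : ℕ) :
    (fun h : ℝ => g (modulate h φ)) =O[atBot] fun h : ℝ => 1 / |h| ^ n := by
  obtain ⟨C, hC⟩ := hg.exists_uniform_decay hG φ n
  refine Asymptotics.IsBigO.of_bound C ?_
  filter_upwards [eventually_le_atBot (-1)] with h hh
  have h0 : 0 < |h| := abs_pos.2 (by linarith)
  have h1 : ‖g (modulate h φ)‖ * |h| ^ n ≤ C := by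
    refine le_of_tendsto ((hg.tendsto_modulate φ h).norm.mul_const (|h| ^ n)) ?_
    filter_upwards [Ioc_mem_nhdsGT (lt_add_one α)] with σ hσ using hC σ hσ h hh
  rw [Real.norm_of_nonneg (by positivity), mul_one_div, le_div_iff₀ (by positivity)]
  exact h1

end

/-! ### From bounds on modulations to local pseudomeasures and pseudofunctions -/

section

variable {G : ℂ → ℂ} {α σ : ℝ} {U : Opens ℝ} {g : 𝓓(U, ℂ) →L[ℂ] ℂ}

theorem IsBoundaryValue.norm_le_polynomial (hG : AnalyticOnNhd ℂ G {s : ℂ | α < s.re})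
    (hg : IsBoundaryValue G α g) (χ : 𝓓(U, ℂ)) :
    ∃ (C : ℝ) (N : ℕ), 0 ≤ C ∧ (∀ h : ℝ, ‖g (modulate h χ)‖ ≤ C * (1 + |h|) ^ N) ∧
      ∀ σ ∈ Ioc α (α + 1), ∀ h : ℝ,
        ‖verticalPairing G σ (modulate h χ)‖ ≤ C * (1 + |h|) ^ N := by
  obtain ⟨C, N, hC⟩ := hg.exists_polynomial_bound hG χ
  have hC' : ∀ h : ℝ, ‖g (modulate h χ)‖ ≤ C * (1 + |h|) ^ N := fun h => by
    refine le_of_tendsto (hg.tendsto_modulate χ h).norm ?_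
    filter_upwards [Ioc_mem_nhdsGT (lt_add_one α)] with σ hσ using hC σ hσ h
  refine ⟨C, N, ?_, hC', hC⟩
  simpa using (norm_nonneg _).trans (hC' 0)

/-- The Fourier side of `χ g`: the function `ξ ↦ ⟨g, e^{-2πiξt} χ(t)⟩` is measurable. -/
theorem IsBoundaryValue.aestronglyMeasurable (hG : AnalyticOnNhd ℂ G {s : ℂ | α < s.re})
    (hg : IsBoundaryValue G α g) (χ : 𝓓(U, ℂ)) :
    AEStronglyMeasurable (fun ξ : ℝ => g (modulate (-(2 * Real.pi * ξ)) χ)) := by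
  obtain ⟨s, -, hs, hsα⟩ := exists_seq_strictAnti_tendsto' (lt_add_one α)
  have hs' : Tendsto s atTop (𝓝[>] α) :=
    tendsto_nhdsWithin_iff.2 ⟨hsα, Eventually.of_forall fun n => (hs n).1⟩
  refine aestronglyMeasurable_of_tendsto_ae atTop
    (f := fun n ξ => verticalPairing G (s n) (modulate (-(2 * Real.pi * ξ)) χ)) (fun n => ?_)
    (Eventually.of_forall fun ξ => (hg.tendsto_modulate χ _).comp hs')
  exact ((continuous_verticalPairing_modulate hG (hs n).1 χ).comp
    (by fun_prop : Continuous fun ξ : ℝ => -(2 * Real.pi * ξ))).aestronglyMeasurable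

/-- Fourier representation of `χ g`. -/
theorem IsBoundaryValue.apply_eq_integral (hG : AnalyticOnNhd ℂ G {s : ℂ | α < s.re})
    (hg : IsBoundaryValue G α g) {χ φ : 𝓓(U, ℂ)} (hφ : ∀ t ∈ tsupport φ, χ t = 1) :
    g φ = ∫ ξ : ℝ, 𝓕⁻ (toSchwartz φ) ξ * g (modulate (-(2 * Real.pi * ξ)) χ) := by
  obtain ⟨C, N, hC0, -, hC⟩ := hg.norm_le_polynomial hG χ
  obtain ⟨s, -, hs, hsα⟩ := exists_seq_strictAnti_tendsto' (lt_add_one α)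
  have hs' : Tendsto s atTop (𝓝[>] α) :=
    tendsto_nhdsWithin_iff.2 ⟨hsα, Eventually.of_forall fun n => (hs n).1⟩
  have hpair : ∀ n, verticalPairing G (s n) φ = ∫ ξ : ℝ, 𝓕⁻ (toSchwartz φ) ξ *
      verticalPairing G (s n) (modulate (-(2 * Real.pi * ξ)) χ) := fun n => by
    have h1 := verticalPairing_mul_eq_integral hG (hs n).1 χ (toSchwartz φ) 0
    simp only [zero_sub] at h1
    rw [← h1]
    congr 1
    funext t
    rw [toSchwartz_apply]
    by_cases ht : t ∈ tsupport φ
    · simp [hφ t ht]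
    · simp [image_eq_zero_of_notMem_tsupport ht]
  refine tendsto_nhds_unique ((hg φ).comp hs') ?_
  change Tendsto (fun n => verticalPairing G (s n) φ) atTop _
  simp only [hpair]
  refine tendsto_integral_of_dominated_convergence
    (fun ξ => C * (‖𝓕⁻ (toSchwartz φ) ξ‖ * (1 + |2 * Real.pi * ξ|) ^ N)) (fun n => ?_)
    ((integrable_norm_mul_one_add_pow (𝓕⁻ (toSchwartz φ)) _ N).const_mul C)
    (fun n => Eventually.of_forall fun ξ => ?_)
    (Eventually.of_forall fun ξ => ((hg.tendsto_modulate χ _).comp hs').const_mul _)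
  · exact ((𝓕⁻ (toSchwartz φ)).continuous.mul
      ((continuous_verticalPairing_modulate hG (hs n).1 χ).comp
        (by fun_prop : Continuous fun ξ : ℝ => -(2 * Real.pi * ξ)))).aestronglyMeasurable
  · rw [norm_mul]
    have h1 := hC (s n) (Ioo_subset_Ioc_self (hs n)) (-(2 * Real.pi * ξ))
    rw [abs_neg] at h1
    calc _ ≤ ‖𝓕⁻ (toSchwartz φ) ξ‖ * (C * (1 + |2 * Real.pi * ξ|) ^ N) := by gcongr
      _ = _ := by ring

/-- Three ranges of `h` are covered: the hypothesis near `+∞`, the automatic decay (with exponent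
`0`) near `-∞`, and the polynomial bound in between. -/
theorem IsBoundaryValue.exists_norm_le_of_isBigO (hG : AnalyticOnNhd ℂ G {s : ℂ | α < s.re})
    (hg : IsBoundaryValue G α g) {χ : 𝓓(U, ℂ)}
    (hχ : (fun h : ℝ => g (modulate h χ)) =O[atTop] fun _ : ℝ => (1 : ℝ)) :
    ∃ M : ℝ, ∀ h : ℝ, ‖g (modulate h χ)‖ ≤ M := by
  obtain ⟨C, N, hC0, hC, -⟩ := hg.norm_le_polynomial hG χ
  obtain ⟨C₁, h₁⟩ := hχ.bound
  obtain ⟨C₂, h₂⟩ := (hg.isBigO_atBot hG χ 0).bound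
  obtain ⟨b, hb⟩ := eventually_atTop.1 h₁
  obtain ⟨a, ha⟩ := eventually_atBot.1 h₂
  simp only [norm_one, mul_one, pow_zero, div_one] at ha hb
  refine ⟨max (max C₁ C₂) (C * (1 + max |a| |b|) ^ N), fun h => ?_⟩
  rcases le_or_gt b h with hbh | hbh
  · exact (hb h hbh).trans ((le_max_left _ _).trans (le_max_left _ _))
  rcases le_or_gt h a with hah | hah
  · exact (ha h hah).trans ((le_max_right _ _).trans (le_max_left _ _))
  · refine (hC h).trans (le_trans ?_ (le_max_right _ _))
    gcongr
    rw [max_comm, abs_le]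
    constructor
    · linarith [neg_abs_le a, le_max_right |b| |a|]
    · linarith [le_abs_self b, le_max_left |b| |a|]

/-- If the Fourier side of `g` is bounded, then near each point of `U` the distribution `g`
coincides with the pseudomeasure whose Fourier transform is `ξ ↦ ⟨g, e^{-2πiξt} χ(t)⟩`. -/
theorem IsBoundaryValue.exists_local_representation
    (hG : AnalyticOnNhd ℂ G {s : ℂ | α < s.re}) (hg : IsBoundaryValue G α g)
    (hO : ∀ φ : 𝓓(U, ℂ), (fun h : ℝ => g (modulate h φ)) =O[atTop] fun _ : ℝ => (1 : ℝ))
    {t₀ : ℝ} (ht₀ : t₀ ∈ U) :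
    ∃ V : Opens ℝ, t₀ ∈ V ∧ V ≤ U ∧ ∃ (χ : 𝓓(U, ℂ)) (u : Lp ℂ ⊤ (volume : Measure ℝ)),
      (∀ᵐ ξ, u ξ = g (modulate (-(2 * Real.pi * ξ)) χ)) ∧
        CoincidesOn g (𝓕⁻ (u : 𝓢'(ℝ, ℂ))) V := by
  obtain ⟨f, hf1, hf2, hf3, hf4⟩ := exists_cutoff isCompact_singleton U.isOpen
    (singleton_subset_iff.2 ht₀)
  let χ : 𝓓(U, ℂ) := ⟨f, hf1, hf2, hf3⟩
  rw [nhdsSet_singleton] at hf4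
  obtain ⟨W, hW, hWo, htW⟩ := eventually_nhds_iff.1 hf4
  obtain ⟨M, hM⟩ := hg.exists_norm_le_of_isBigO hG (hO χ)
  have hmem : MemLp (fun ξ : ℝ => g (modulate (-(2 * Real.pi * ξ)) χ)) ⊤ volume :=
    memLp_top_of_bound (hg.aestronglyMeasurable hG χ) M (Eventually.of_forall fun ξ => hM _)
  refine ⟨⟨W, hWo⟩ ⊓ U, ⟨htW, ht₀⟩, inf_le_right, χ, hmem.toLp, hmem.coeFn_toLp,
    fun φ hφ => ?_⟩
  rw [TemperedDistribution.fourierInv_apply, Lp.toTemperedDistribution_apply,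
    hg.apply_eq_integral hG (χ := χ) fun t ht => hW t (hφ ht).1]
  refine integral_congr_ae ?_
  filter_upwards [hmem.coeFn_toLp] with ξ hξ
  rw [hξ, smul_eq_mul]

theorem IsBoundaryValue.isLocalPseudomeasure (hG : AnalyticOnNhd ℂ G {s : ℂ | α < s.re})
    (hg : IsBoundaryValue G α g)
    (hO : ∀ φ : 𝓓(U, ℂ), (fun h : ℝ => g (modulate h φ)) =O[atTop] fun _ : ℝ => (1 : ℝ)) :
    IsLocalPseudomeasure g := fun _ ht₀ => by
  obtain ⟨V, htV, hVU, χ, u, -, huV⟩ := hg.exists_local_representation hG hO ht₀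
  exact ⟨V, htV, hVU, _, ⟨u, by simp⟩, huV⟩

theorem IsBoundaryValue.isLocalPseudofunction (hG : AnalyticOnNhd ℂ G {s : ℂ | α < s.re})
    (hg : IsBoundaryValue G α g)
    (ho : ∀ φ : 𝓓(U, ℂ), (fun h : ℝ => g (modulate h φ)) =o[atTop] fun _ : ℝ => (1 : ℝ)) :
    IsLocalPseudofunction g := fun _ ht₀ => by
  obtain ⟨V, htV, hVU, χ, u, hu, huV⟩ :=
    hg.exists_local_representation hG (fun φ => (ho φ).isBigO) ht₀
  refine ⟨V, htV, hVU, _, ⟨u, by simp, ?_⟩, huV⟩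
  have htop : Tendsto (fun h : ℝ => g (modulate h χ)) atTop (𝓝 0) :=
    (Asymptotics.isLittleO_one_iff ℝ).1 (ho χ)
  have hbot : Tendsto (fun h : ℝ => g (modulate h χ)) atBot (𝓝 0) := by
    refine (hg.isBigO_atBot hG χ 1).trans_tendsto ?_
    simp only [pow_one, one_div]
    exact tendsto_abs_atBot_atTop.inv_tendsto_atTop
  have hpi : 0 < 2 * Real.pi := by positivity
  -- The sign flips: `ξ → -∞` uses the hypothesis at `h → +∞`, while `ξ → +∞` uses the automatic
  -- decay at `h → -∞`.
  have hlim : Tendsto (fun ξ : ℝ => g (modulate (-(2 * Real.pi * ξ)) χ)) (cocompact ℝ) (𝓝 0) := by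
    rw [cocompact_eq_atBot_atTop]
    refine Tendsto.sup ?_ ?_
    · exact htop.comp (tendsto_neg_atBot_atTop.comp (tendsto_id.const_mul_atBot hpi))
    · exact hbot.comp (tendsto_neg_atTop_atBot.comp (tendsto_id.const_mul_atTop hpi))
  refine (hlim.mono_left inf_le_left).congr' (EventuallyEq.symm ?_)
  exact hu.filter_mono inf_le_right

end

/-! ### From local pseudomeasures and pseudofunctions to bounds on modulations -/

section

variable {U : Opens ℝ} {g : 𝓓(U, ℂ) →L[ℂ] ℂ}

/-- A property of test functions which is additive and holds locally holds for all of them. -/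
theorem testFunction_induction {P : 𝓓(U, ℂ) → Prop} (h0 : P 0)
    (hadd : ∀ φ ψ, P φ → P ψ → P (φ + ψ))
    (hloc : ∀ t ∈ U, ∃ V : Opens ℝ, t ∈ V ∧ ∀ φ : 𝓓(U, ℂ), tsupport φ ⊆ V → P φ)
    (φ : 𝓓(U, ℂ)) : P φ := by
  choose! V htV hV using hloc
  have key : ∀ (s : Finset ℝ), (∀ t ∈ s, t ∈ U) → ∀ φ : 𝓓(U, ℂ),
      tsupport φ ⊆ ⋃ t ∈ s, (V t : Set ℝ) → P φ := by
    classical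
    intro s
    induction s using Finset.induction_on with
    | empty =>
      intro _ φ hφ
      have : φ = 0 := by
        ext t
        exact image_eq_zero_of_notMem_tsupport fun ht => by simpa using hφ ht
      rwa [this]
    | insert a s _ ih =>
      intro hs φ hφ
      set W : Set ℝ := ⋃ t ∈ s, (V t : Set ℝ) with hW
      have hWo : IsOpen W := isOpen_biUnion fun t _ => (V t).isOpen
      have hφ' : tsupport φ ⊆ V a ∪ W := by simpa [hW] using hφ
      -- The cutoff is `1` near the part of the support missed by `W`, so `ρ φ` lives in `V a` and
      -- `(1 - ρ) φ` in `W`.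
      obtain ⟨ρ, hρ1, hρ2, hρ3, hρ4⟩ := exists_cutoff
        (φ.hasCompactSupport.diff hWo : IsCompact (tsupport φ \ W)) (V a).isOpen
        fun t ht => (hφ' ht.1).resolve_right ht.2
      let φ₁ : 𝓓(U, ℂ) := ⟨fun t => ρ t * φ t, hρ1.mul φ.contDiff, φ.hasCompactSupport.mul_left,
        tsupport_mul_subset_right.trans φ.tsupport_subset⟩
      let φ₂ : 𝓓(U, ℂ) := ⟨fun t => (1 - ρ t) * φ t, (contDiff_const.sub hρ1).mul φ.contDiff,
        φ.hasCompactSupport.mul_left, tsupport_mul_subset_right.trans φ.tsupport_subset⟩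
      have hsum : φ = φ₁ + φ₂ := by
        ext t
        change φ t = ρ t * φ t + (1 - ρ t) * φ t
        ring
      rw [hsum]
      refine hadd _ _ (hV a (hs a (by simp)) φ₁ (tsupport_mul_subset_left.trans hρ3))
        (ih (fun t ht => hs t (by simp [ht])) φ₂ fun t ht => ?_)
      by_contra htW
      have h1 : ∀ᶠ x in 𝓝 t, ρ x = 1 :=
        hρ4.filter_mono (nhds_le_nhdsSet
          (show t ∈ tsupport φ \ W from ⟨tsupport_mul_subset_right ht, htW⟩))
      refine notMem_tsupport_iff_eventuallyEq.2 (h1.mono fun x hx => ?_) ht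
      change (1 - ρ x) * φ x = 0
      simp [hx]
  obtain ⟨s, hsU, hs⟩ := φ.hasCompactSupport.elim_nhds_subcover (fun t => (V t : Set ℝ))
    fun t ht => (V t).isOpen.mem_nhds (htV t (φ.tsupport_subset ht))
  exact key s (fun t ht => φ.tsupport_subset (hsU t ht)) φ hs

theorem modulate_zero (h : ℝ) : modulate h (0 : 𝓓(U, ℂ)) = 0 := by
  ext t
  simp [modulate_apply]

theorem modulate_add (h : ℝ) (φ ψ : 𝓓(U, ℂ)) :
    modulate h (φ + ψ) = modulate h φ + modulate h ψ := by
  ext t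
  simp [modulate_apply, mul_add]

theorem fourierInv_toSchwartz_modulate (φ : 𝓓(U, ℂ)) (h ξ : ℝ) :
    𝓕⁻ (toSchwartz (modulate h φ)) ξ = 𝓕⁻ (toSchwartz φ) (ξ + h / (2 * Real.pi)) := by
  rw [SchwartzMap.fourierInv_coe, SchwartzMap.fourierInv_coe, Real.fourierInv_eq',
    Real.fourierInv_eq']
  refine integral_congr_ae (Eventually.of_forall fun t => ?_)
  simp only [toSchwartz_apply, modulate_apply, smul_eq_mul]
  rw [← mul_assoc, ← Complex.exp_add]
  congr 2
  have := Real.pi_ne_zero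
  simp
  field_simp

/-- Modulation translates the inverse transform by `h / (2π)`; translation invariance of Lebesgue
measure moves the shift onto `u`. -/
theorem apply_toSchwartz_modulate {f : 𝓢'(ℝ, ℂ)} {u : Lp ℂ ⊤ (volume : Measure ℝ)}
    (hu : 𝓕 f = (u : 𝓢'(ℝ, ℂ))) (φ : 𝓓(U, ℂ)) (h : ℝ) :
    f (toSchwartz (modulate h φ)) =
      ∫ ξ : ℝ, 𝓕⁻ (toSchwartz φ) ξ * u (ξ - h / (2 * Real.pi)) := by
  have h1 : f (toSchwartz (modulate h φ)) = 𝓕 f (𝓕⁻ (toSchwartz (modulate h φ))) := by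
    rw [TemperedDistribution.fourier_apply]; simp
  rw [h1, hu, Lp.toTemperedDistribution_apply,
    ← integral_sub_right_eq_self _ (h / (2 * Real.pi))]
  refine integral_congr_ae (Eventually.of_forall fun ξ => ?_)
  simp only [fourierInv_toSchwartz_modulate, smul_eq_mul, sub_add_cancel]

theorem ae_norm_sub_le (u : Lp ℂ ⊤ (volume : Measure ℝ)) (c : ℝ) : ∀ᵐ ξ, ‖u (ξ - c)‖ ≤ ‖u‖ := by
  refine (measurePreserving_sub_right volume c).quasiMeasurePreserving.ae
    (p := fun ξ => ‖u ξ‖ ≤ ‖u‖) ?_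
  filter_upwards [ae_le_eLpNormEssSup (f := u) (μ := volume)] with ξ hξ
  rw [Lp.norm_def, eLpNorm_exponent_top, ← toReal_enorm]
  exact ENNReal.toReal_mono (by simpa using Lp.eLpNorm_ne_top u) hξ

/-- Setting `u` to zero off a countable intersection of conull sets, one for each tolerance
`1/(n+1)`, gives a representative with a genuine limit, usable pointwise in dominated convergence.
-/
theorem exists_ae_eq_tendsto_cocompact {u : ℝ → ℂ}
    (hu : Tendsto u (cocompact ℝ ⊓ ae volume) (𝓝 0)) :
    ∃ v : ℝ → ℂ, u =ᵐ[volume] v ∧ Tendsto v (cocompact ℝ) (𝓝 0) := by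
  have h1 : ∀ n : ℕ, ∃ s ∈ cocompact ℝ, ∃ t ∈ ae (volume : Measure ℝ),
      ∀ x ∈ s ∩ t, ‖u x‖ < 1 / ((n : ℝ) + 1) := fun n => by
    have h2 : ∀ᶠ x in cocompact ℝ ⊓ ae volume, ‖u x‖ < 1 / ((n : ℝ) + 1) :=
      hu.norm.eventually_lt_const (by rw [norm_zero]; positivity)
    obtain ⟨s, hs, t, ht, hst⟩ := mem_inf_iff_superset.1 h2
    exact ⟨s, hs, t, ht, fun x hx => hst hx⟩
  choose s hs t ht hst using h1
  refine ⟨(⋂ n, t n).indicator u, ?_, ?_⟩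
  · filter_upwards [countable_iInter_mem.2 ht] with x hx
    rw [indicator_of_mem hx]
  · rw [NormedAddGroup.tendsto_nhds_zero]
    intro ε hε
    obtain ⟨n, hn⟩ := exists_nat_one_div_lt hε
    filter_upwards [hs n] with x hx
    by_cases hxt : x ∈ ⋂ n, t n
    · rw [indicator_of_mem hxt]
      exact (hst n x ⟨hx, mem_iInter.1 hxt n⟩).trans hn
    · simpa [indicator_of_notMem hxt] using hε

theorem isBigO_of_isPseudomeasure {f : 𝓢'(ℝ, ℂ)} (hf : IsPseudomeasure f) (φ : 𝓓(U, ℂ)) :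
    (fun h : ℝ => f (toSchwartz (modulate h φ))) =O[atTop] fun _ : ℝ => (1 : ℝ) := by
  obtain ⟨u, hu⟩ := hf
  refine Asymptotics.IsBigO.of_bound ((∫ ξ, ‖𝓕⁻ (toSchwartz φ) ξ‖) * ‖u‖)
    (Eventually.of_forall fun h => ?_)
  rw [apply_toSchwartz_modulate hu, norm_one, mul_one, ← integral_mul_const]
  refine norm_integral_le_of_norm_le ((𝓕⁻ (toSchwartz φ)).integrable.norm.mul_const _) ?_
  filter_upwards [ae_norm_sub_le u (h / (2 * Real.pi))] with ξ hξ
  rw [norm_mul]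
  gcongr

/-- The Riemann–Lebesgue property of pseudofunctions. -/
theorem isLittleO_of_isPseudofunction {f : 𝓢'(ℝ, ℂ)} (hf : IsPseudofunction f) (φ : 𝓓(U, ℂ)) :
    (fun h : ℝ => f (toSchwartz (modulate h φ))) =o[atTop] fun _ : ℝ => (1 : ℝ) := by
  obtain ⟨u, hu, hu0⟩ := hf
  obtain ⟨v, huv, hv⟩ := exists_ae_eq_tendsto_cocompact hu0
  rw [Asymptotics.isLittleO_one_iff]
  have huv' : ∀ c : ℝ, ∀ᵐ ξ : ℝ, u (ξ - c) = v (ξ - c) := fun c =>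
    (measurePreserving_sub_right volume c).quasiMeasurePreserving.ae huv
  have h1 : ∀ h : ℝ, f (toSchwartz (modulate h φ)) =
      ∫ ξ : ℝ, 𝓕⁻ (toSchwartz φ) ξ * v (ξ - h / (2 * Real.pi)) := fun h => by
    rw [apply_toSchwartz_modulate hu]
    refine integral_congr_ae ?_
    filter_upwards [huv' (h / (2 * Real.pi))] with ξ hξ
    rw [hξ]
  simp only [h1]
  have h2 : Tendsto (fun h : ℝ => ∫ ξ : ℝ, 𝓕⁻ (toSchwartz φ) ξ * v (ξ - h / (2 * Real.pi))) atTop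
      (𝓝 (∫ ξ : ℝ, (0 : ℂ))) := by
    refine tendsto_integral_filter_of_dominated_convergence
      (fun ξ => ‖𝓕⁻ (toSchwartz φ) ξ‖ * ‖u‖) (Eventually.of_forall fun h => ?_)
      (Eventually.of_forall fun h => ?_)
      ((𝓕⁻ (toSchwartz φ)).integrable.norm.mul_const _) (Eventually.of_forall fun ξ => ?_)
    · refine (𝓕⁻ (toSchwartz φ)).continuous.aestronglyMeasurable.mul ?_
      exact ((Lp.aestronglyMeasurable u).congr huv).comp_measurePreserving
        (measurePreserving_sub_right volume _)
    · filter_upwards [huv' (h / (2 * Real.pi)), ae_norm_sub_le u (h / (2 * Real.pi))] with ξ hξ hξ'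
      rw [norm_mul, ← hξ]
      gcongr
    · have h3 : Tendsto (fun h : ℝ => ξ - h / (2 * Real.pi)) atTop (cocompact ℝ) := by
        refine Tendsto.mono_right ?_ atBot_le_cocompact
        exact tendsto_atBot_add_const_left _ ξ
          (tendsto_neg_atTop_atBot.comp (tendsto_id.atTop_div_const (by positivity)))
      simpa using (hv.comp h3).const_mul (𝓕⁻ (toSchwartz φ) ξ)
  simpa using h2

theorem tsupport_modulate_subset (h : ℝ) (φ : 𝓓(U, ℂ)) : tsupport (modulate h φ) ⊆ tsupport φ :=
  tsupport_mul_subset_right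

theorem IsLocalPseudomeasure.isBigO (hg : IsLocalPseudomeasure g) (φ : 𝓓(U, ℂ)) :
    (fun h : ℝ => g (modulate h φ)) =O[atTop] fun _ : ℝ => (1 : ℝ) := by
  refine testFunction_induction
    (P := fun φ => (fun h : ℝ => g (modulate h φ)) =O[atTop] fun _ : ℝ => (1 : ℝ)) ?_ ?_ ?_ φ
  · simpa [modulate_zero] using Asymptotics.isBigO_zero (E' := ℂ) (fun _ : ℝ => (1 : ℝ)) atTop
  · intro φ ψ hφ hψ
    simpa [modulate_add] using hφ.add hψ
  · intro t ht
    obtain ⟨V, htV, -, f, hf, hfg⟩ := hg t ht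
    refine ⟨V, htV, fun φ hφ => ?_⟩
    simp only [fun h => hfg (modulate h φ) ((tsupport_modulate_subset h φ).trans hφ)]
    exact isBigO_of_isPseudomeasure hf φ

theorem IsLocalPseudofunction.isLittleO (hg : IsLocalPseudofunction g) (φ : 𝓓(U, ℂ)) :
    (fun h : ℝ => g (modulate h φ)) =o[atTop] fun _ : ℝ => (1 : ℝ) := by
  refine testFunction_induction
    (P := fun φ => (fun h : ℝ => g (modulate h φ)) =o[atTop] fun _ : ℝ => (1 : ℝ)) ?_ ?_ ?_ φ
  · simp [modulate_zero]
  · intro φ ψ hφ hψ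
    simpa [modulate_add] using hφ.add hψ
  · intro t ht
    obtain ⟨V, htV, -, f, hf, hfg⟩ := hg t ht
    refine ⟨V, htV, fun φ hφ => ?_⟩
    simp only [fun h => hfg (modulate h φ) ((tsupport_modulate_subset h φ).trans hφ)]
    exact isLittleO_of_isPseudofunction hf φ

end

end PseudoDist

end

theorem mainTheorem6 (U : Opens ℝ) (α : ℝ) (G : ℂ → ℂ)
    (hG : AnalyticOnNhd ℂ G {s : ℂ | α < s.re})
    (g : 𝓓(U, ℂ) →L[ℂ] ℂ) (hg : PseudoDist.IsBoundaryValue G α g) :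
    (∀ (φ : 𝓓(U, ℂ)) (n : ℕ),
      Asymptotics.IsBigO atBot (fun h : ℝ => g (PseudoDist.modulate h φ))
        (fun h : ℝ => 1 / |h| ^ n)) ∧
    (PseudoDist.IsLocalPseudofunction g ↔
      ∀ φ : 𝓓(U, ℂ),
        Asymptotics.IsLittleO atTop (fun h : ℝ => g (PseudoDist.modulate h φ))
          (fun _ : ℝ => (1 : ℝ))) ∧
    (PseudoDist.IsLocalPseudomeasure g ↔
      ∀ φ : 𝓓(U, ℂ),
        Asymptotics.IsBigO atTop (fun h : ℝ => g (PseudoDist.modulate h φ))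
          (fun _ : ℝ => (1 : ℝ))) :=
  ⟨fun φ n => hg.isBigO_atBot hG φ n,
    ⟨fun h φ => h.isLittleO φ, fun h => hg.isLocalPseudofunction hG h⟩,
    ⟨fun h φ => h.isBigO φ, fun h => hg.isLocalPseudomeasure hG h⟩⟩
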